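/- Let $W^1,\dots,W^m$ be independent Brownian motions on a filtered probability space $(\Omega,\mathfrak F,(\mathfrak F_t)_{t\ge 0},\mathbb P)$, adapted to the filtration and such that $(W^k_t-W^k_s)_{k}$ is independent of $\mathfrak F_s$ for $s\le t$. Let $b,\sigma_1,\dots,\sigma_m:[0,T]\times\mathbb R^d\to\mathbb R^d$ be measurable (in particular, they may be smooth), let $\tau$ be a stopping time with values in $[0,T]$, and let $Y$ ($\mathbb R^d$-valued), $\Delta\ge 0$ and $d_i,\widetilde d_i$ ($i=1,\dots,d$) be $\mathfrak F_\tau$-measurable random variables with $\widetilde d_i\ge d_i>0$. Consider one Euler–Maruyama step $$Y(\tau+\Delta)=Y+b(\tau,Y)\,\Delta+\sum_{k=1}^m\sigma_k(\tau,Y)\,\bigl(W^k_{\tau+\Delta}-W^k_\tau\bigr).$$ Let $\|\cdot\|_{\mathbb R^d}$ be a weighted $\ell^p$ norm on $\mathbb R^d$ ($1\le p\le\infty$, positive weights), and let $\|\cdot\|_{\mathbb R^{d\times d}}$ be a norm on the real $d\times d$ matrices that is absolute, $\|A\|_{\mathbb R^{d\times d}}=\|(|A^{i,j}|)_{i,j}\|_{\mathbb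 R^{d\times d}}$ for all $A$, and satisfies $\|xy^\top\|_{\mathbb R^{d\times d}}\le\|x\|_{\mathbb R^d}\|y\|_{\mathbb R^d}$ for all $x,y\in\mathbb R^d$. Then the conditional moments $\mathbb E(Y^i(\tau+\Delta)\mid\mathfrak F_\tau)$ and $\mathbb E((Y^i(\tau+\Delta)-Y^i)(Y^j(\tau+\Delta)-Y^j)\mid\mathfrak F_\tau)$ exist for all $i,j$ (in the usual extended sense: $g=\mathbb E(f\mid\mathcal G)$ means that there are $A_1\subseteq A_2\subseteq\cdots$ in $\mathcal G$ with union $\Omega$ such that, for every $n$, $f\mathbf 1_{A_n}$ is integrable and $g=\mathbb E(f\mathbf 1_{A_n}\mid\mathcal G)$ almost surely on $A_n$; for integrable $f$ this is the ordinary conditional expectation), and almost surely $$\left\|\left(\frac{\mathbb E\bigl((Y^i(\tau+\Delta)-Y^i)(Y^j(\tau+\Delta)-Y^j)\mid\mathfrak F_\tau\bigr)}{2\,\widetilde d_i\,\widetilde d_j}\right)_{i,j}\right\|_{\mathbb R^{d\times d}}\le\frac{\Delta^2}{2}\left\|\left(\frac{b^i(\tau,Y)}{d_i}\right)_i\right\|_{\mathbb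 R^d}^2+\frac{\Delta}{2}\sum_{k=1}^m\left\|\left(\frac{\sigma_k^i(\tau,Y)}{\widetilde d_i}\right)_i\right\|_{\mathbb R^d}^2 .$$ Consequently, let $$L(\Delta)=\max\left\{\left\|\left(\frac{\mathbb E(Y^i(\tau+\Delta)\mid\mathfrak F_\tau)-Y^i}{d_i}\right)_i\right\|_{\mathbb R^d},\ \left\|\left(\frac{\mathbb E\bigl((Y^i(\tau+\Delta)-Y^i)(Y^j(\tau+\Delta)-Y^j)\mid\mathfrak F_\tau\bigr)}{2\,\widetilde d_i\,\widetilde d_j}\right)_{i,j}\right\|_{\mathbb R^{d\times d}}\right\}$$ be the local discrepancy function, and $$\widetilde L(\Delta)=\Delta\,\max\left\{\left\|\left(\frac{b^i(\tau,Y)}{d_i}\right)_i\right\|_{\mathbb R^d},\ \sum_{k=1}^m\left\|\left(\frac{\sigma_k^i(\tau,Y)}{\widetilde d_i}\right)_i\right\|_{\mathbb R^d}^2\right\}$$ the ancillary one. Then, almost surely, $\widetilde L(\Delta)\le 1$ implies $L(\Delta)\le\widetilde L(\Delta)\le 1$. -/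

import Mathlib

open MeasureTheory ProbabilityTheory
open scoped NNReal ENNReal

noncomputable section

/-- `W = (W¹, …, Wᵐ)` are independent standard real Brownian motions relative to the filtration
`𝓕`: each one is a Brownian motion with almost surely continuous paths, they are mutually
independent, adapted to `𝓕`, and the (vector) increments after time `s` are independent of `𝓕 s`. -/
structure IsFilteredBrownian {Ω : Type*} {mΩ : MeasurableSpace Ω} {m : ℕ} (P : Measure Ω)
    (𝓕 : Filtration ℝ≥0 mΩ) (W : Fin m → ℝ≥0 → Ω → ℝ) : Prop where
  brownian : ∀ k, IsBrownianReal (W k) P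
  indep : iIndepFun (fun (k : Fin m) (ω : Ω) (t : ℝ≥0) => W k t ω) P
  adapted : ∀ k t, Measurable[𝓕 t] (W k t)
  indep_increments : ∀ s t : ℝ≥0, s ≤ t →
    Indep (𝓕 s)
      (MeasurableSpace.comap (fun (ω : Ω) (k : Fin m) => W k t ω - W k s ω) inferInstance) P

/-- `g` is a version of the conditional expectation `E(f | 𝓖)` of a `σ`-integrable random variable:
there are events `A 0 ⊆ A 1 ⊆ …` in `𝓖` exhausting `Ω` such that `f` is integrable on
each `A n` and `g = E(1_{A n} f | 𝓖)` almost surely on `A n`.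
For integrable `f` this is the usual conditional expectation (see `isCondExp_condExp` and
`IsCondExp.ae_eq`). -/
def IsCondExp {Ω : Type*} (𝓖 : MeasurableSpace Ω) {_mΩ : MeasurableSpace Ω} (P : Measure Ω)
    (f g : Ω → ℝ) : Prop :=
  ∃ A : ℕ → Set Ω, (∀ n, MeasurableSet[𝓖] (A n)) ∧ Monotone A ∧ (⋃ n, A n) = Set.univ ∧
    ∀ n, IntegrableOn f (A n) P ∧
      ∀ᵐ ω ∂P, ω ∈ A n → g ω = (P[(A n).indicator f | 𝓖]) ω

theorem isCondExp_condExp {Ω : Type*} (𝓖 : MeasurableSpace Ω) {_mΩ : MeasurableSpace Ω}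
    (P : Measure Ω) {f : Ω → ℝ} (hf : Integrable f P) : IsCondExp 𝓖 P f (P[f | 𝓖]) :=
  ⟨fun _ => Set.univ, fun _ => MeasurableSet.univ, monotone_const, by simp [Set.iUnion_const],
    fun _ => ⟨hf.integrableOn, by simp⟩⟩

theorem IsCondExp.ae_eq {Ω : Type*} {𝓖 : MeasurableSpace Ω} {mΩ : MeasurableSpace Ω}
    {P : Measure Ω} [IsFiniteMeasure P] (h𝓖 : 𝓖 ≤ mΩ) {f g g' : Ω → ℝ}
    (hg : IsCondExp 𝓖 P f g) (hg' : IsCondExp 𝓖 P f g') : g =ᵐ[P] g' := by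
  obtain ⟨A, hA, -, hAu, hAg⟩ := hg
  obtain ⟨B, hB, -, hBu, hBg⟩ := hg'
  have key : ∀ n k, ∀ᵐ ω ∂P, ω ∈ A n → ω ∈ B k → g ω = g' ω := by
    intro n k
    have h1 := condExp_indicator (m := 𝓖) (μ := P) (f := (A n).indicator f)
      ((integrable_indicator_iff (h𝓖 _ (hA n))).2 (hAg n).1) (hB k)
    have h2 := condExp_indicator (m := 𝓖) (μ := P) (f := (B k).indicator f)
      ((integrable_indicator_iff (h𝓖 _ (hB k))).2 (hBg k).1) (hA n)
    rw [Set.indicator_indicator] at h1 h2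
    rw [Set.inter_comm (A n) (B k)] at h2
    filter_upwards [h1, h2, (hAg n).2, (hBg k).2] with ω e1 e2 e3 e4 hωA hωB
    rw [e3 hωA, e4 hωB]
    rw [Set.indicator_of_mem hωB] at e1
    rw [Set.indicator_of_mem hωA] at e2
    rw [← e1, ← e2]
  have key' : ∀ᵐ ω ∂P, ∀ n k, ω ∈ A n → ω ∈ B k → g ω = g' ω :=
    ae_all_iff.2 fun n => ae_all_iff.2 fun k => key n k
  filter_upwards [key'] with ω hω
  obtain ⟨n, hn⟩ := Set.mem_iUnion.1 (hAu ▸ Set.mem_univ ω)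
  obtain ⟨k, hk⟩ := Set.mem_iUnion.1 (hBu ▸ Set.mem_univ ω)
  exact hω n k hn hk

/-- The weighted `ℓᵖ` norm `‖(wᵢ xᵢ)ᵢ‖_{ℓᵖ}` on `ℝᵈ`. (For `p < ∞`, weights placed
inside the sum, `(∑ᵢ vᵢ |xᵢ|ᵖ)^(1/p)`, correspond to `wᵢ = vᵢ^(1/p)`.) -/
def weightedLpNorm {d : ℕ} (p : ℝ≥0∞) (w : Fin d → ℝ) (x : Fin d → ℝ) : ℝ :=
  ‖WithLp.toLp p (fun i => w i * x i)‖

/-- One Euler–Maruyama step of (random) length `Δ` started from `Y` at time `τ`. -/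
def eulerStep {Ω : Type*} {d m : ℕ} (b : ℝ≥0 → (Fin d → ℝ) → Fin d → ℝ)
    (σ : Fin m → ℝ≥0 → (Fin d → ℝ) → Fin d → ℝ) (W : Fin m → ℝ≥0 → Ω → ℝ)
    (τ : Ω → ℝ≥0) (Y : Ω → Fin d → ℝ) (Δ : Ω → ℝ≥0) (ω : Ω) (i : Fin d) : ℝ :=
  Y ω i + b (τ ω) (Y ω) i * (Δ ω : ℝ) +
    ∑ k, σ k (τ ω) (Y ω) i * (W k (τ ω + Δ ω) ω - W k (τ ω) ω)

/-- The local discrepancy function `L` (additional approximation equal to `Y`, supremum norm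
on `ℝ²`, thresholds `thr i` and `thr' i * thr' j`). Here `M₁ i` and `M₂ i j` stand for
the conditional first moments of the Euler step and the conditional second moments of its increment,
`nv` and `nm` for the norms on vectors and matrices. -/
def localDiscrepancy {Ω : Type*} {d : ℕ} (nv : (Fin d → ℝ) → ℝ)
    (nm : Matrix (Fin d) (Fin d) ℝ → ℝ) (thr thr' : Fin d → Ω → ℝ) (Y : Ω → Fin d → ℝ)
    (M₁ : Fin d → Ω → ℝ) (M₂ : Fin d → Fin d → Ω → ℝ) (ω : Ω) : ℝ :=
  max (nv fun i => (M₁ i ω - Y ω i) / thr i ω)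
    (nm (Matrix.of fun i j => M₂ i j ω / (2 * (thr' i ω * thr' j ω))))

/-- The ancillary local discrepancy function, which involves the coefficients only. -/
def ancillaryDiscrepancy {Ω : Type*} {d m : ℕ} (nv : (Fin d → ℝ) → ℝ)
    (thr thr' : Fin d → Ω → ℝ) (b : ℝ≥0 → (Fin d → ℝ) → Fin d → ℝ)
    (σ : Fin m → ℝ≥0 → (Fin d → ℝ) → Fin d → ℝ)
    (τ : Ω → ℝ≥0) (Y : Ω → Fin d → ℝ) (Δ : Ω → ℝ≥0) (ω : Ω) : ℝ :=
  (Δ ω : ℝ) * max (nv fun i => b (τ ω) (Y ω) i / thr i ω)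
    (∑ k, (nv fun i => σ k (τ ω) (Y ω) i / thr' i ω) ^ 2)

end

/-!
Given `𝓕_τ`, the increment `X = W(τ + Δ) - W(τ)` is distributed as `√Δ Z` with `Z` a standard
Gaussian vector independent of `𝓕_τ` (`IsFilteredBrownian.map_restrict_increment`). This form of the
strong Markov property, with a random but `𝓕_τ`-measurable length `Δ`, comes from rounding `τ` and
`Δ` up to a grid, where independence of the increments applies on each of countably many events,
and from letting the mesh go to zero along the continuous paths. The convergence is used against
bounded continuous functions only, so that no uniform integrability is needed; the limit identifies
the law of `X` on every event of `𝓕_τ`, hence its moments.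

On the event that `Δ`, `Y`, `b(τ, Y)` and the `σ_k(τ, Y)` are bounded by `n`, the conditional mean of
`X` is therefore zero and its conditional covariance matrix is `Δ` times the identity. Expanding the
Euler step and pulling out the `𝓕_τ`-measurable factors yields
`E(Yⁱ(τ + Δ) | 𝓕_τ) = Yⁱ + bⁱ Δ` and the second moments `Δ² bⁱ bʲ + Δ ∑ₖ σₖⁱ σₖʲ` of the increment
(`IsFilteredBrownian.isCondExp_step`).

The scaled second moment matrix is thus a nonnegative combination of the rank one matrices `x xᵀ`
with `x = b / d̃` and `x = σ_k / d̃`, so the triangle inequality, the compatibility of the two norms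
and `d ≤ d̃` give the first estimate (`Seminorm.secondMoment_le`). The comparison of the two
discrepancy functions follows because `Δ ‖b / d‖ ≤ 1` lets one drop the square in the quadratic term
(`sq_div_two_add_le_mul_max`).
-/

/-! ### Rounding up to a grid -/

/-- The right end point of the cell of the grid `ℕ / (n + 1)` that contains `x`. -/
noncomputable def gridCeil (n : ℕ) (x : ℝ≥0) : ℝ≥0 := ((⌊((n : ℝ≥0) + 1) * x⌋₊ : ℝ≥0) + 1) / (n + 1)

theorem le_gridCeil (n : ℕ) (x : ℝ≥0) : x ≤ gridCeil n x := by
  rw [gridCeil, le_div_iff₀ (by positivity), mul_comm]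
  exact (Nat.lt_floor_add_one _).le

theorem gridCeil_le (n : ℕ) (x : ℝ≥0) : gridCeil n x ≤ x + 1 / ((n : ℝ≥0) + 1) := by
  rw [gridCeil, div_le_iff₀ (by positivity), add_mul x, one_div,
    inv_mul_cancel₀ (by positivity : (n : ℝ≥0) + 1 ≠ 0), mul_comm x]
  gcongr
  exact Nat.floor_le zero_le

theorem tendsto_gridCeil (x : ℝ≥0) :
    Filter.Tendsto (fun n => gridCeil n x) Filter.atTop (nhds x) := by
  refine tendsto_of_tendsto_of_tendsto_of_le_of_le tendsto_const_nhds ?_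
    (fun n => le_gridCeil n x) (fun n => gridCeil_le n x)
  simpa using tendsto_const_nhds (x := x).add
    (tendsto_one_div_add_atTop_nhds_zero_nat (𝕜 := ℝ≥0))

/-! ### Stopping times -/

section StoppingTime

variable {Ω : Type*} {mΩ : MeasurableSpace Ω} {𝓕 : Filtration ℝ≥0 mΩ} {τ : Ω → ℝ≥0}

/-- A finite stopping time is `𝓕_τ`-measurable as a map into `ℝ≥0`, not only into `WithTop ℝ≥0`. -/
theorem MeasureTheory.IsStoppingTime.measurable_of_coe
    (hτ : IsStoppingTime 𝓕 (fun ω => (τ ω : WithTop ℝ≥0))) : Measurable[hτ.measurableSpace] τ := by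
  refine @measurable_of_Iic _ _ _ _ _ hτ.measurableSpace _ _ _ τ fun t => ?_
  have h := hτ.measurableSet_le' t
  simp only [WithTop.coe_le_coe] at h
  exact h

end StoppingTime

/-! ### The strong Markov property -/

section Increments

variable {Ω : Type*} {mΩ : MeasurableSpace Ω} {P : Measure Ω}
  {𝓕 : Filtration ℝ≥0 mΩ} {m : ℕ} {W : Fin m → ℝ≥0 → Ω → ℝ}

theorem IsFilteredBrownian.measurable (hW : IsFilteredBrownian P 𝓕 W) (k : Fin m) (t : ℝ≥0) :
    Measurable (W k t) :=
  (hW.adapted k t).mono (𝓕.le t) le_rfl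

/-- An increment over a deterministic interval of length `δ` has the law of `√δ Z` with `Z` standard
Gaussian on `ℝᵐ`. -/
theorem IsFilteredBrownian.map_increment [IsProbabilityMeasure P] (hW : IsFilteredBrownian P 𝓕 W) (s δ : ℝ≥0) :
    P.map (fun ω k => W k (s + δ) ω - W k s ω) =
      (Measure.pi fun _ : Fin m => gaussianReal 0 1).map (fun z k => √(δ : ℝ) * z k) := by
  have hmeas := hW.measurable
  have hind : iIndepFun (fun (k : Fin m) ω => W k (s + δ) ω - W k s ω) P :=
    hW.indep.comp (fun _ f => f (s + δ) - f s) (fun _ => by fun_prop)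
  have hX : ∀ k : Fin m, Measurable fun ω => W k (s + δ) ω - W k s ω :=
    fun k => (hmeas k _).sub (hmeas k _)
  rw [(iIndepFun_iff_map_fun_eq_pi_map fun k => (hX k).aemeasurable).1 hind]
  rw [Measure.pi_map_pi (f := fun (_ : Fin m) (x : ℝ) => √(δ : ℝ) * x) (fun _ => by fun_prop)]
  congr 1
  funext k
  have h := ((hW.brownian k).toIsPreBrownianReal.hasLaw_sub (s + δ) s).map_eq
  rw [gaussianReal_map_const_mul]
  refine Eq.trans h ?_
  congr 1
  · simp
  · ext
    simp

open BoundedContinuousFunction in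
/-- On an event of `𝓕 s`, the increment after `s` can be replaced by an independent Gaussian
vector. -/
theorem IsFilteredBrownian.setIntegral_increment [IsProbabilityMeasure P] (hW : IsFilteredBrownian P 𝓕 W) {s δ : ℝ≥0}
    {B : Set Ω} (hB : MeasurableSet[𝓕 s] B) (φ : (Fin m → ℝ) →ᵇ ℝ) :
    ∫ ω in B, φ (fun k => W k (s + δ) ω - W k s ω) ∂P =
      ∫ _ω in B, ∫ z, φ (fun k => √(δ : ℝ) * z k)
        ∂(Measure.pi fun _ : Fin m => gaussianReal 0 1) ∂P := by
  have hmeas := hW.measurable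
  have hX : Measurable fun ω (k : Fin m) => W k (s + δ) ω - W k s ω :=
    measurable_pi_lambda _ fun k => (hmeas k _).sub (hmeas k _)
  have hint : Integrable (fun ω => φ (fun k => W k (s + δ) ω - W k s ω)) P :=
    (integrable_const ‖φ‖).mono' (φ.continuous.measurable.comp hX).aestronglyMeasurable
      (ae_of_all _ fun ω => φ.norm_coe_le_norm _)
  have hce := condExp_indep_eq (μ := P) hX.comap_le (𝓕.le s)
    (f := fun ω => φ (fun k => W k (s + δ) ω - W k s ω))
    (φ.continuous.measurable.comp (comap_measurable _)).stronglyMeasurable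
    (hW.indep_increments s (s + δ) le_self_add).symm
  rw [← setIntegral_condExp (𝓕.le s) hint hB,
    setIntegral_congr_ae (𝓕.le s _ hB) (hce.mono fun _ h _ => h)]
  have hmap : ∫ ω, φ (fun k => W k (s + δ) ω - W k s ω) ∂P =
      ∫ z, φ (fun k => √(δ : ℝ) * z k) ∂(Measure.pi fun _ : Fin m => gaussianReal 0 1) := by
    have h1 := integral_map (μ := P) hX.aemeasurable (f := φ)
      φ.continuous.aestronglyMeasurable
    have h2 := integral_map (μ := Measure.pi fun _ : Fin m => gaussianReal 0 1)
      (φ := fun z (k : Fin m) => √(δ : ℝ) * z k)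
      (Measurable.aemeasurable (by fun_prop)) (f := φ) φ.continuous.aestronglyMeasurable
    rw [← h1, ← h2, hW.map_increment s δ]
  rw [hmap]

variable {τ Δ : Ω → ℝ≥0}

theorem measurable_apply_countable {ι α β : Type*} [Countable ι] [MeasurableSpace ι]
    [MeasurableSingletonClass ι] [MeasurableSpace α] [MeasurableSpace β] {u : ι → α → β}
    (hu : ∀ i, Measurable (u i)) {f : α → ι} (hf : Measurable f) : Measurable fun a => u (f a) a :=
  (measurable_from_prod_countable_right (f := Function.uncurry u) hu).comp
    (hf.prodMk measurable_id)

theorem IsFilteredBrownian.measurable_gridIncrement (hW : IsFilteredBrownian P 𝓕 W)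
    (hτ : Measurable τ) (hΔ : Measurable Δ) (n : ℕ) :
    Measurable fun ω k => W k (gridCeil n (τ ω) + gridCeil n (Δ ω)) ω -
      W k (gridCeil n (τ ω)) ω := by
  have hτ' : Measurable fun ω => ⌊((n : ℝ≥0) + 1) * τ ω⌋₊ :=
    Nat.measurable_floor.comp (hτ.const_mul ((n : ℝ≥0) + 1))
  have hΔ' : Measurable fun ω => ⌊((n : ℝ≥0) + 1) * Δ ω⌋₊ :=
    Nat.measurable_floor.comp (hΔ.const_mul ((n : ℝ≥0) + 1))
  refine measurable_pi_lambda _ fun k => ?_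
  have hWg : ∀ q : ℕ × ℕ, Measurable fun ω =>
      W k (((q.1 : ℝ≥0) + 1) / (n + 1) + ((q.2 : ℝ≥0) + 1) / (n + 1)) ω -
        W k (((q.1 : ℝ≥0) + 1) / (n + 1)) ω :=
    fun q => (hW.measurable k _).sub (hW.measurable k _)
  have h := measurable_apply_countable hWg (hτ'.prodMk hΔ')
  dsimp only at h
  simp only [gridCeil]
  exact h

open BoundedContinuousFunction in
/-- The strong Markov property on a grid: the event is cut into the countably many pieces on which
the discretized time and step-size are constant. A piece on which the discretized time equals `s`
lies in `𝓕 s`, because discretizing rounds up. -/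
theorem IsFilteredBrownian.setIntegral_gridIncrement [IsProbabilityMeasure P] (hW : IsFilteredBrownian P 𝓕 W)
    (hτ : IsStoppingTime 𝓕 (fun ω => (τ ω : WithTop ℝ≥0)))
    (hΔ : Measurable[hτ.measurableSpace] Δ) {A : Set Ω} (hA : MeasurableSet[hτ.measurableSpace] A)
    (φ : (Fin m → ℝ) →ᵇ ℝ) (n : ℕ) :
    ∫ ω in A, φ (fun k => W k (gridCeil n (τ ω) + gridCeil n (Δ ω)) ω -
        W k (gridCeil n (τ ω)) ω) ∂P =
      ∫ ω in A, ∫ z, φ (fun k => √(gridCeil n (Δ ω) : ℝ) * z k)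
        ∂(Measure.pi fun _ : Fin m => gaussianReal 0 1) ∂P := by
  have hle := hτ.measurableSpace_le
  have hτm := hτ.measurable_of_coe
  set K : Ω → ℕ × ℕ := fun ω =>
    (⌊((n : ℝ≥0) + 1) * τ ω⌋₊, ⌊((n : ℝ≥0) + 1) * Δ ω⌋₊) with hK
  have hKm : Measurable[hτ.measurableSpace] K :=
    ((Nat.measurable_floor.comp (hτm.const_mul ((n : ℝ≥0) + 1)))).prodMk
    (Nat.measurable_floor.comp (hΔ.const_mul ((n : ℝ≥0) + 1)))
  set S : ℕ × ℕ → Set Ω := fun q => A ∩ K ⁻¹' {q} with hS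
  have hSm : ∀ q, MeasurableSet[hτ.measurableSpace] (S q) := fun q =>
    hA.inter (hKm (measurableSet_singleton q))
  have hSA : (⋃ q, S q) = A := by
    rw [hS, ← Set.inter_iUnion, ← Set.preimage_iUnion, Set.iUnion_of_singleton]
    simp
  have hdisj : Pairwise (Function.onFun Disjoint S) := by
    intro q r hqr
    rw [Function.onFun, Set.disjoint_left]
    rintro ω ⟨-, h1⟩ ⟨-, h2⟩
    exact hqr (h1.symm.trans h2)
  have hmeasK := hKm.mono hle le_rfl
  have hint1 : IntegrableOn (fun ω => φ (fun k => W k (gridCeil n (τ ω) + gridCeil n (Δ ω)) ω -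
        W k (gridCeil n (τ ω)) ω)) (⋃ q, S q) P :=
    ((integrable_const ‖φ‖).mono' (φ.continuous.measurable.comp
      (hW.measurable_gridIncrement (hτm.mono hle le_rfl) (hΔ.mono hle le_rfl)
        n)).aestronglyMeasurable (ae_of_all _ fun ω => φ.norm_coe_le_norm _)).integrableOn
  have hint2 : IntegrableOn (fun ω => ∫ z, φ (fun k => √(gridCeil n (Δ ω) : ℝ) * z k)
        ∂(Measure.pi fun _ : Fin m => gaussianReal 0 1)) (⋃ q, S q) P := by
    refine ((integrable_const ‖φ‖).mono' ?_ (ae_of_all _ fun ω => ?_)).integrableOn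
    · have : Measurable fun q : ℕ × ℕ => ∫ z, φ (fun k => √(((q.2 : ℝ≥0) + 1) / (n + 1) : ℝ≥0) * z k)
        ∂(Measure.pi fun _ : Fin m => gaussianReal 0 1) := measurable_of_countable _
      exact (this.comp hmeasK).aestronglyMeasurable
    · refine (norm_integral_le_of_norm_le_const (ae_of_all _ fun z =>
        φ.norm_coe_le_norm _)).trans ?_
      simp
  have h1 := hasSum_integral_iUnion (fun q => hle _ (hSm q)) hdisj hint1
  have h2 := hasSum_integral_iUnion (fun q => hle _ (hSm q)) hdisj hint2
  rw [hSA] at h1 h2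
  refine h1.unique ?_
  convert h2 using 2 with q
  have hB : MeasurableSet[𝓕 (((q.1 : ℝ≥0) + 1) / (n + 1))] (S q) := by
    have h := ((hτ.measurableSet _).1 (hSm q)).2 (((q.1 : ℝ≥0) + 1) / (n + 1))
    -- On the piece `S q` the rounded-up time, hence `τ`, is at most `(q.1 + 1) / (n + 1)`.
    convert h using 1
    refine (Set.inter_eq_left.2 ?_).symm
    rintro ω ⟨-, hω⟩
    have h3 : ⌊((n : ℝ≥0) + 1) * τ ω⌋₊ = q.1 := congrArg Prod.fst hω
    have h4 := le_gridCeil n (τ ω)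
    rw [gridCeil, h3] at h4
    exact WithTop.coe_le_coe.2 h4
  have h5 := hW.setIntegral_increment (δ := ((q.2 : ℝ≥0) + 1) / (n + 1)) hB φ
  have h6 : ∀ ω ∈ S q, gridCeil n (τ ω) = ((q.1 : ℝ≥0) + 1) / (n + 1) ∧
      gridCeil n (Δ ω) = ((q.2 : ℝ≥0) + 1) / (n + 1) := by
    rintro ω ⟨-, hω⟩
    have h3 : ⌊((n : ℝ≥0) + 1) * τ ω⌋₊ = q.1 := congrArg Prod.fst hω
    have h4 : ⌊((n : ℝ≥0) + 1) * Δ ω⌋₊ = q.2 := congrArg Prod.snd hω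
    simp only [gridCeil, h3, h4, and_self]
  rw [setIntegral_congr_fun (hle _ (hSm q)) (g := fun ω => φ (fun k =>
    W k (((q.1 : ℝ≥0) + 1) / (n + 1) + ((q.2 : ℝ≥0) + 1) / (n + 1)) ω -
      W k (((q.1 : ℝ≥0) + 1) / (n + 1)) ω)), h5]
  · refine setIntegral_congr_fun (hle _ (hSm q)) fun ω hω => ?_
    simp only [(h6 ω hω).2]
  · intro ω hω
    simp only [(h6 ω hω).1, (h6 ω hω).2]

theorem IsFilteredBrownian.ae_tendsto_gridIncrement (hW : IsFilteredBrownian P 𝓕 W) :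
    ∀ᵐ ω ∂P, Filter.Tendsto (fun (n : ℕ) (k : Fin m) =>
      W k (gridCeil n (τ ω) + gridCeil n (Δ ω)) ω - W k (gridCeil n (τ ω)) ω) Filter.atTop
      (nhds fun k => W k (τ ω + Δ ω) ω - W k (τ ω) ω) := by
  filter_upwards [ae_all_iff.2 fun k => (hW.brownian k).cont] with ω hω
  rw [tendsto_pi_nhds]
  intro k
  exact (((hω k).tendsto _).comp ((tendsto_gridCeil _).add (tendsto_gridCeil _))).sub
    (((hω k).tendsto _).comp (tendsto_gridCeil _))

/-- Only almost every path is continuous, so the increment is merely a.e. measurable. -/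
theorem IsFilteredBrownian.aemeasurable_increment [IsProbabilityMeasure P] (hW : IsFilteredBrownian P 𝓕 W)
    (hτ : Measurable τ) (hΔ : Measurable Δ) :
    AEMeasurable (fun ω k => W k (τ ω + Δ ω) ω - W k (τ ω) ω) P :=
  aemeasurable_of_tendsto_metrizable_ae Filter.atTop
    (fun n => (hW.measurable_gridIncrement hτ hΔ n).aemeasurable) hW.ae_tendsto_gridIncrement

/-- The strong Markov property: given `𝓕_τ`, the increment over `[τ, τ + Δ]` has the law of `√Δ Z`
with an independent standard Gaussian vector `Z`. It passes to the limit from the grid since the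
paths are continuous. -/
theorem IsFilteredBrownian.map_restrict_increment [IsProbabilityMeasure P] (hW : IsFilteredBrownian P 𝓕 W)
    (hτ : IsStoppingTime 𝓕 (fun ω => (τ ω : WithTop ℝ≥0)))
    (hΔ : Measurable[hτ.measurableSpace] Δ) {A : Set Ω}
    (hA : MeasurableSet[hτ.measurableSpace] A) :
    (P.restrict A).map (fun ω k => W k (τ ω + Δ ω) ω - W k (τ ω) ω) =
      ((P.restrict A).prod (Measure.pi fun _ : Fin m => gaussianReal 0 1)).map
        (fun q k => √(Δ q.1 : ℝ) * q.2 k) := by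
  have hle := hτ.measurableSpace_le
  have hτ' : Measurable τ := hτ.measurable_of_coe.mono hle le_rfl
  have hΔ' : Measurable Δ := hΔ.mono hle le_rfl
  have hX := hW.aemeasurable_increment hτ' hΔ'
  have hX' : AEMeasurable (fun ω k => W k (τ ω + Δ ω) ω - W k (τ ω) ω) (P.restrict A) :=
    hX.mono_measure Measure.restrict_le_self
  have hZ : Measurable fun (q : Ω × (Fin m → ℝ)) (k : Fin m) => √(Δ q.1 : ℝ) * q.2 k := by
    fun_prop
  refine ext_of_forall_integral_eq_of_IsFiniteMeasure fun φ => ?_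
  rw [integral_map hX' φ.continuous.aestronglyMeasurable,
    integral_map hZ.aemeasurable φ.continuous.aestronglyMeasurable, integral_prod]
  swap
  · exact (integrable_const ‖φ‖).mono' (φ.continuous.measurable.comp hZ).aestronglyMeasurable
      (ae_of_all _ fun ω => φ.norm_coe_le_norm _)
  set Φ : ℝ≥0 → ℝ := fun δ => ∫ z, φ (fun k => √(δ : ℝ) * z k)
    ∂(Measure.pi fun _ : Fin m => gaussianReal 0 1) with hΦ
  have hΦc : Continuous Φ := by
    refine continuous_of_dominated (bound := fun _ => ‖φ‖) (fun δ => ?_)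
      (fun δ => ae_of_all _ fun z => φ.norm_coe_le_norm _) (integrable_const _)
      (ae_of_all _ fun z => ?_)
    · exact (φ.continuous.comp (by fun_prop)).aestronglyMeasurable
    · exact φ.continuous.comp (by fun_prop)
  have hΦb : ∀ δ, ‖Φ δ‖ ≤ ‖φ‖ := fun δ => by
    refine (norm_integral_le_of_norm_le_const (ae_of_all _ fun z =>
        φ.norm_coe_le_norm _)).trans ?_
    simp
  have hgrid : ∀ n, Measurable (gridCeil n) := fun n => by
    have : Measurable fun j : ℕ => ((j : ℝ≥0) + 1) / ((n : ℝ≥0) + 1) := measurable_of_countable _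
    exact this.comp (Nat.measurable_floor.comp (measurable_id.const_mul ((n : ℝ≥0) + 1)))
  have hlim1 := tendsto_integral_of_dominated_convergence (μ := P.restrict A)
    (F := fun (n : ℕ) ω => φ (fun k => W k (gridCeil n (τ ω) + gridCeil n (Δ ω)) ω -
        W k (gridCeil n (τ ω)) ω))
    (f := fun ω => φ (fun k => W k (τ ω + Δ ω) ω - W k (τ ω) ω)) (fun _ => ‖φ‖)
    (fun n => (φ.continuous.measurable.comp
      (hW.measurable_gridIncrement hτ' hΔ' n)).aestronglyMeasurable) (integrable_const _)
    (fun n => ae_of_all _ fun ω => φ.norm_coe_le_norm _)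
    ((ae_restrict_of_ae hW.ae_tendsto_gridIncrement).mono fun ω h =>
      (φ.continuous.tendsto _).comp h)
  have hlim2 := tendsto_integral_of_dominated_convergence (μ := P.restrict A)
    (F := fun (n : ℕ) ω => Φ (gridCeil n (Δ ω))) (f := fun ω => Φ (Δ ω)) (fun _ => ‖φ‖)
    (fun n => (hΦc.measurable.comp ((hgrid n).comp hΔ')).aestronglyMeasurable)
    (integrable_const _) (fun n => ae_of_all _ fun ω => hΦb _)
    (ae_of_all _ fun ω => (hΦc.tendsto _).comp (tendsto_gridCeil _))
  refine tendsto_nhds_unique hlim1 ?_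
  simp only [hW.setIntegral_gridIncrement hτ hΔ hA φ]
  exact hlim2

end Increments

/-! ### Gaussian moments -/

section GaussianMoments

variable {m : ℕ}

theorem memLp_eval_pi_gaussianReal (k : Fin m) :
    MemLp (fun z : Fin m → ℝ => z k) 2 (Measure.pi fun _ : Fin m => gaussianReal 0 1) :=
  (memLp_id_gaussianReal (μ := 0) (v := 1) 2).comp_measurePreserving
    (measurePreserving_eval (fun _ : Fin m => gaussianReal 0 1) k)

theorem integral_eval_pi_gaussianReal (k : Fin m) :
    ∫ z : Fin m → ℝ, z k ∂(Measure.pi fun _ : Fin m => gaussianReal 0 1) = 0 := by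
  rw [integral_comp_eval (μ := fun _ : Fin m => gaussianReal 0 1) (i := k)
    (f := fun x : ℝ => x) aestronglyMeasurable_id]
  exact integral_id_gaussianReal

theorem integral_eval_mul_eval_pi_gaussianReal (k l : Fin m) :
    ∫ z : Fin m → ℝ, z k * z l ∂(Measure.pi fun _ : Fin m => gaussianReal 0 1) =
      if k = l then 1 else 0 := by
  split_ifs with h
  · subst h
    rw [integral_comp_eval (μ := fun _ : Fin m => gaussianReal 0 1) (i := k)
      (f := fun x : ℝ => x * x) (by fun_prop)]
    have h := variance_of_integral_eq_zero (μ := gaussianReal 0 1) (X := id)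
      aemeasurable_id integral_id_gaussianReal
    rw [variance_id_gaussianReal] at h
    simpa [pow_two] using h.symm
  · have hind := (iIndepFun_pi (μ := fun _ : Fin m => gaussianReal 0 1) (X := fun _ x => x)
      (fun _ => aemeasurable_id)).indepFun h
    have := hind.integral_fun_mul_eq_mul_integral (measurable_pi_apply k).aestronglyMeasurable
      (measurable_pi_apply l).aestronglyMeasurable
    rw [this, integral_eval_pi_gaussianReal, zero_mul]

end GaussianMoments

/-! ### Moments of the increment -/

section IncrementMoments

variable {Ω : Type*} {mΩ : MeasurableSpace Ω} {P : Measure Ω} [IsProbabilityMeasure P]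
  {𝓕 : Filtration ℝ≥0 mΩ} {m : ℕ} {W : Fin m → ℝ≥0 → Ω → ℝ} {τ Δ : Ω → ℝ≥0}

/-- Moments of the increment over `[τ, τ + Δ]` on events of `𝓕_τ` are those of `√Δ Z`. -/
theorem IsFilteredBrownian.integrableOn_comp_increment_iff (hW : IsFilteredBrownian P 𝓕 W)
    (hτ : IsStoppingTime 𝓕 (fun ω => (τ ω : WithTop ℝ≥0)))
    (hΔ : Measurable[hτ.measurableSpace] Δ) {A : Set Ω}
    (hA : MeasurableSet[hτ.measurableSpace] A) {φ : (Fin m → ℝ) → ℝ} (hφ : Continuous φ) :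
    (IntegrableOn (fun ω => φ (fun k => W k (τ ω + Δ ω) ω - W k (τ ω) ω)) A P ↔
      Integrable (fun q => φ (fun k => √(Δ q.1 : ℝ) * q.2 k))
        ((P.restrict A).prod (Measure.pi fun _ : Fin m => gaussianReal 0 1))) ∧
    ∫ ω in A, φ (fun k => W k (τ ω + Δ ω) ω - W k (τ ω) ω) ∂P =
      ∫ q, φ (fun k => √(Δ q.1 : ℝ) * q.2 k)
        ∂((P.restrict A).prod (Measure.pi fun _ : Fin m => gaussianReal 0 1)) := by
  have hle := hτ.measurableSpace_le
  have hΔ' : Measurable Δ := hΔ.mono hle le_rfl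
  have hX := (hW.aemeasurable_increment (hτ.measurable_of_coe.mono hle le_rfl)
    hΔ').mono_measure (Measure.restrict_le_self (s := A))
  have hZ : Measurable fun (q : Ω × (Fin m → ℝ)) (k : Fin m) => √(Δ q.1 : ℝ) * q.2 k := by
    fun_prop
  have hmap := hW.map_restrict_increment hτ hΔ hA
  constructor
  · have h1 := integrable_map_measure (f := fun ω k => W k (τ ω + Δ ω) ω - W k (τ ω) ω)
      hφ.aestronglyMeasurable hX
    have h2 := integrable_map_measure (μ := (P.restrict A).prod
      (Measure.pi fun _ : Fin m => gaussianReal 0 1)) hφ.aestronglyMeasurable hZ.aemeasurable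
    rw [hmap] at h1
    exact h1.symm.trans h2
  · have h1 := integral_map hX hφ.aestronglyMeasurable
    have h2 := integral_map (μ := (P.restrict A).prod
      (Measure.pi fun _ : Fin m => gaussianReal 0 1)) hZ.aemeasurable hφ.aestronglyMeasurable
    rw [← h1, ← h2, hmap]

variable {A : Set Ω} {C : ℝ}

theorem integrableOn_of_bound {f : Ω → ℝ} (hA : MeasurableSet A) (hf : Measurable f)
    (hC : ∀ ω ∈ A, ‖f ω‖ ≤ C) : IntegrableOn f A P :=
  (integrable_const C).mono' hf.aestronglyMeasurable
    ((ae_restrict_iff' hA).2 (ae_of_all _ hC))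

theorem IsFilteredBrownian.setIntegral_increment_eq_zero (hW : IsFilteredBrownian P 𝓕 W)
    (hτ : IsStoppingTime 𝓕 (fun ω => (τ ω : WithTop ℝ≥0)))
    (hΔ : Measurable[hτ.measurableSpace] Δ) (hA : MeasurableSet[hτ.measurableSpace] A)
    (hC : ∀ ω ∈ A, (Δ ω : ℝ) ≤ C) (k : Fin m) :
    IntegrableOn (fun ω => W k (τ ω + Δ ω) ω - W k (τ ω) ω) A P ∧
      ∫ ω in A, (W k (τ ω + Δ ω) ω - W k (τ ω) ω) ∂P = 0 := by
  have hle := hτ.measurableSpace_le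
  have hΔ' : Measurable Δ := hΔ.mono hle le_rfl
  obtain ⟨h1, h2⟩ := hW.integrableOn_comp_increment_iff hτ hΔ hA
    (φ := fun x => x k) (continuous_apply k)
  refine ⟨h1.2 ?_, h2.trans ?_⟩
  · refine Integrable.mul_prod (f := fun ω => √(Δ ω : ℝ)) (g := fun z : Fin m → ℝ => z k)
      ?_ ((memLp_eval_pi_gaussianReal k).integrable one_le_two)
    refine integrableOn_of_bound (C := √C) (hle _ hA) (by fun_prop) fun ω hω => ?_
    rw [Real.norm_of_nonneg (Real.sqrt_nonneg _)]
    exact Real.sqrt_le_sqrt (hC ω hω)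
  · rw [integral_prod_mul (fun ω => √(Δ ω : ℝ)) (fun z : Fin m → ℝ => z k),
      integral_eval_pi_gaussianReal, mul_zero]

theorem IsFilteredBrownian.setIntegral_increment_mul_increment (hW : IsFilteredBrownian P 𝓕 W)
    (hτ : IsStoppingTime 𝓕 (fun ω => (τ ω : WithTop ℝ≥0)))
    (hΔ : Measurable[hτ.measurableSpace] Δ) (hA : MeasurableSet[hτ.measurableSpace] A)
    (hC : ∀ ω ∈ A, (Δ ω : ℝ) ≤ C) (k l : Fin m) :
    IntegrableOn (fun ω => (W k (τ ω + Δ ω) ω - W k (τ ω) ω) *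
        (W l (τ ω + Δ ω) ω - W l (τ ω) ω)) A P ∧
      ∫ ω in A, (W k (τ ω + Δ ω) ω - W k (τ ω) ω) *
        (W l (τ ω + Δ ω) ω - W l (τ ω) ω) ∂P =
      ∫ ω in A, (if k = l then (Δ ω : ℝ) else 0) ∂P := by
  have hle := hτ.measurableSpace_le
  have hΔ' : Measurable Δ := hΔ.mono hle le_rfl
  obtain ⟨h1, h2⟩ := hW.integrableOn_comp_increment_iff hτ hΔ hA
    (φ := fun x => x k * x l) (by fun_prop)
  have h3 : ∀ q : Ω × (Fin m → ℝ), √(Δ q.1 : ℝ) * q.2 k * (√(Δ q.1 : ℝ) * q.2 l) =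
      (Δ q.1 : ℝ) * (q.2 k * q.2 l) := fun q => by
    rw [mul_mul_mul_comm, Real.mul_self_sqrt (Δ q.1).coe_nonneg]
  simp only [h3] at h1 h2
  refine ⟨h1.2 ?_, h2.trans ?_⟩
  · refine Integrable.mul_prod (f := fun ω => (Δ ω : ℝ))
      (g := fun z : Fin m → ℝ => z k * z l)
      ?_ ((memLp_eval_pi_gaussianReal k).integrable_mul (memLp_eval_pi_gaussianReal l))
    refine integrableOn_of_bound (C := C) (hle _ hA) (by fun_prop) fun ω hω => ?_
    rw [Real.norm_of_nonneg (Δ ω).coe_nonneg]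
    exact hC ω hω
  · rw [integral_prod_mul (fun ω => (Δ ω : ℝ)) (fun z : Fin m → ℝ => z k * z l),
      integral_eval_mul_eval_pi_gaussianReal]
    split_ifs <;> simp

end IncrementMoments

/-! ### Conditional expectations on an event -/

section CondExpOn

variable {Ω : Type*}

/-- `g` is a version of `E(f | 𝓖)` on the event `A`, on which `f` is integrable; nothing is said
about `f` and `g` off `A`. -/
def IsCondExpOn (𝓖 : MeasurableSpace Ω) {_mΩ : MeasurableSpace Ω} (P : Measure Ω) (A : Set Ω)
    (f g : Ω → ℝ) : Prop :=
  IntegrableOn f A P ∧ P[A.indicator f | 𝓖] =ᵐ[P] A.indicator g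

variable {𝓖 mΩ : MeasurableSpace Ω} {P : Measure Ω} {A : Set Ω} {f f' g g' c : Ω → ℝ}

theorem IsCondExpOn.add (h𝓖 : 𝓖 ≤ mΩ) (hA : MeasurableSet[𝓖] A) (h : IsCondExpOn 𝓖 P A f g)
    (h' : IsCondExpOn 𝓖 P A f' g') :
    IsCondExpOn 𝓖 P A (fun ω => f ω + f' ω) (fun ω => g ω + g' ω) := by
  refine ⟨h.1.add h'.1, ?_⟩
  have h1 := condExp_add (m := 𝓖) (h.1.integrable_indicator (h𝓖 _ hA))
    (h'.1.integrable_indicator (h𝓖 _ hA))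
  rw [← Set.indicator_add'] at h1
  refine h1.trans ((h.2.add h'.2).trans ?_)
  rw [← Set.indicator_add']
  rfl

theorem IsCondExpOn.sum {ι : Type*} (s : Finset ι) (h𝓖 : 𝓖 ≤ mΩ) (hA : MeasurableSet[𝓖] A)
    {f g : ι → Ω → ℝ} (h : ∀ i ∈ s, IsCondExpOn 𝓖 P A (f i) (g i)) :
    IsCondExpOn 𝓖 P A (fun ω => ∑ i ∈ s, f i ω) (fun ω => ∑ i ∈ s, g i ω) := by
  classical
  induction s using Finset.induction_on with
  | empty =>
    refine ⟨by simp, ?_⟩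
    simp only [Finset.sum_empty, Set.indicator_zero]
    exact (condExp_zero (m := 𝓖) (μ := P) (E := ℝ)).eventuallyEq
  | insert i s hi ih =>
    simp only [Finset.sum_insert hi]
    exact (h i (Finset.mem_insert_self i s)).add h𝓖 hA
      (ih fun j hj => h j (Finset.mem_insert_of_mem hj))

theorem IsCondExpOn.mul_left [IsFiniteMeasure P] (h𝓖 : 𝓖 ≤ mΩ) (hA : MeasurableSet[𝓖] A)
    (h : IsCondExpOn 𝓖 P A f g) (hc : Measurable[𝓖] c) (hb : ∃ C, ∀ ω ∈ A, |c ω| ≤ C) :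
    IsCondExpOn 𝓖 P A (fun ω => c ω * f ω) (fun ω => c ω * g ω) := by
  obtain ⟨C, hC⟩ := hb
  have hcm : StronglyMeasurable[𝓖] (A.indicator c) := (hc.indicator hA).stronglyMeasurable
  have hb : ∀ ω, ‖A.indicator c ω‖ ≤ |C| := fun ω => by
    by_cases hω : ω ∈ A
    · rw [Set.indicator_of_mem hω]
      exact (hC ω hω).trans (le_abs_self C)
    · rw [Set.indicator_of_notMem hω]
      simp
  have hprod : ∀ u : Ω → ℝ, A.indicator (fun ω => c ω * u ω) = A.indicator c * A.indicator u :=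
    fun u => Set.indicator_mul A c u
  have hfi := h.1.integrable_indicator (h𝓖 _ hA)
  refine ⟨?_, ?_⟩
  · rw [← integrable_indicator_iff (h𝓖 _ hA), hprod]
    exact hfi.bdd_mul (hcm.mono h𝓖).aestronglyMeasurable (ae_of_all _ hb)
  · rw [hprod, hprod]
    refine (condExp_stronglyMeasurable_mul_of_bound h𝓖 hcm hfi |C| (ae_of_all _ hb)).trans ?_
    exact (Filter.EventuallyEq.refl _ (A.indicator c)).mul h.2

theorem isCondExpOn_self [IsFiniteMeasure P] (h𝓖 : 𝓖 ≤ mΩ) (hA : MeasurableSet[𝓖] A)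
    (hc : Measurable[𝓖] c) (hb : ∃ C, ∀ ω ∈ A, |c ω| ≤ C) : IsCondExpOn 𝓖 P A c c := by
  obtain ⟨C, hC⟩ := hb
  have hint : IntegrableOn c A P := (integrable_const C).mono'
    (hc.mono h𝓖 le_rfl).aestronglyMeasurable ((ae_restrict_iff' (h𝓖 _ hA)).2 (ae_of_all _ hC))
  refine ⟨hint, ?_⟩
  rw [condExp_of_stronglyMeasurable h𝓖 (hc.indicator hA).stronglyMeasurable
    (hint.integrable_indicator (h𝓖 _ hA))]

theorem isCondExpOn_of_setIntegral_eq [IsFiniteMeasure P] (h𝓖 : 𝓖 ≤ mΩ)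
    (hA : MeasurableSet[𝓖] A) (hf : IntegrableOn f A P) (hg : IntegrableOn g A P)
    (hgm : Measurable[𝓖] g)
    (h : ∀ s, MeasurableSet[𝓖] s → s ⊆ A → ∫ ω in s, f ω ∂P = ∫ ω in s, g ω ∂P) :
    IsCondExpOn 𝓖 P A f g := by
  refine ⟨hf, (ae_eq_condExp_of_forall_setIntegral_eq h𝓖 (hf.integrable_indicator (h𝓖 _ hA))
    (fun s _ _ => (hg.integrable_indicator (h𝓖 _ hA)).integrableOn) (fun s hs _ => ?_)
    (hgm.indicator hA).stronglyMeasurable.aestronglyMeasurable).symm⟩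
  rw [setIntegral_indicator (h𝓖 _ hA), setIntegral_indicator (h𝓖 _ hA)]
  exact (h _ (hs.inter hA) Set.inter_subset_right).symm

theorem isCondExp_of_isCondExpOn {A : ℕ → Set Ω} (hA : ∀ n, MeasurableSet[𝓖] (A n))
    (hmono : Monotone A) (hu : (⋃ n, A n) = Set.univ) (h : ∀ n, IsCondExpOn 𝓖 P (A n) f g) :
    IsCondExp 𝓖 P f g :=
  ⟨A, hA, hmono, hu, fun n => ⟨(h n).1, (h n).2.mono fun ω hω hωA => by
    rw [hω, Set.indicator_of_mem hωA]⟩⟩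

theorem exists_bound_mul {c c' : Ω → ℝ} (h : ∃ C, ∀ ω ∈ A, |c ω| ≤ C)
    (h' : ∃ C, ∀ ω ∈ A, |c' ω| ≤ C) : ∃ C, ∀ ω ∈ A, |c ω * c' ω| ≤ C := by
  obtain ⟨C, hC⟩ := h
  obtain ⟨C', hC'⟩ := h'
  refine ⟨C * C', fun ω hω => ?_⟩
  rw [abs_mul]
  exact mul_le_mul (hC ω hω) (hC' ω hω) (abs_nonneg _) ((abs_nonneg _).trans (hC ω hω))

end CondExpOn

/-! ### Conditional moments of the Euler step -/

section EulerMoments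

variable {Ω : Type*} {mΩ : MeasurableSpace Ω} {P : Measure Ω} [IsProbabilityMeasure P]
  {𝓕 : Filtration ℝ≥0 mΩ} {m : ℕ} {W : Fin m → ℝ≥0 → Ω → ℝ} {τ Δ : Ω → ℝ≥0} {A : Set Ω}

theorem IsFilteredBrownian.isCondExpOn_increment (hW : IsFilteredBrownian P 𝓕 W)
    (hτ : IsStoppingTime 𝓕 (fun ω => (τ ω : WithTop ℝ≥0)))
    (hΔ : Measurable[hτ.measurableSpace] Δ) (hA : MeasurableSet[hτ.measurableSpace] A)
    (hC : ∃ C, ∀ ω ∈ A, |(Δ ω : ℝ)| ≤ C) (k : Fin m) :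
    IsCondExpOn hτ.measurableSpace P A (fun ω => W k (τ ω + Δ ω) ω - W k (τ ω) ω)
      (fun _ => 0) := by
  obtain ⟨C, hC⟩ := hC
  have hC' : ∀ ω ∈ A, (Δ ω : ℝ) ≤ C := fun ω hω => (le_abs_self _).trans (hC ω hω)
  refine isCondExpOn_of_setIntegral_eq hτ.measurableSpace_le hA
    (hW.setIntegral_increment_eq_zero hτ hΔ hA hC' k).1 integrableOn_zero measurable_const
    fun s hs hsA => ?_
  rw [(hW.setIntegral_increment_eq_zero hτ hΔ hs (fun ω hω => hC' ω (hsA hω)) k).2]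
  simp

theorem IsFilteredBrownian.isCondExpOn_increment_mul_increment (hW : IsFilteredBrownian P 𝓕 W)
    (hτ : IsStoppingTime 𝓕 (fun ω => (τ ω : WithTop ℝ≥0)))
    (hΔ : Measurable[hτ.measurableSpace] Δ) (hA : MeasurableSet[hτ.measurableSpace] A)
    (hC : ∃ C, ∀ ω ∈ A, |(Δ ω : ℝ)| ≤ C) (k l : Fin m) :
    IsCondExpOn hτ.measurableSpace P A
      (fun ω => (W k (τ ω + Δ ω) ω - W k (τ ω) ω) * (W l (τ ω + Δ ω) ω - W l (τ ω) ω))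
      (fun ω => if k = l then (Δ ω : ℝ) else 0) := by
  obtain ⟨C, hC⟩ := hC
  have hle := hτ.measurableSpace_le
  have hC' : ∀ ω ∈ A, (Δ ω : ℝ) ≤ C := fun ω hω => (le_abs_self _).trans (hC ω hω)
  have hm : Measurable[hτ.measurableSpace] fun ω => if k = l then (Δ ω : ℝ) else 0 := by
    split_ifs
    · exact measurable_coe_nnreal_real.comp hΔ
    · exact measurable_const
  refine isCondExpOn_of_setIntegral_eq hle hA
    (hW.setIntegral_increment_mul_increment hτ hΔ hA hC' k l).1
    (integrableOn_of_bound (C := C) (hle _ hA) (hm.mono hle le_rfl) fun ω hω => ?_) hm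
    fun s hs hsA =>
      (hW.setIntegral_increment_mul_increment hτ hΔ hs (fun ω hω => hC' ω (hsA hω)) k l).2
  split_ifs
  · exact hC ω hω
  · simpa using (abs_nonneg _).trans (hC ω hω)

variable {d : ℕ} {β : Ω → Fin d → ℝ} {s : Fin m → Ω → Fin d → ℝ} {Y : Ω → Fin d → ℝ}

/-- Conditional first and second moments of `Y + β Δ + ∑ₖ sₖ (Wᵏ(τ + Δ) - Wᵏ(τ))` for
`𝓕_τ`-measurable `Y`, `β` and `sₖ`. Integrability holds on the events on which these and `Δ` are
bounded by `n`. -/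
theorem IsFilteredBrownian.isCondExp_step (hW : IsFilteredBrownian P 𝓕 W)
    (hτ : IsStoppingTime 𝓕 (fun ω => (τ ω : WithTop ℝ≥0)))
    (hΔ : Measurable[hτ.measurableSpace] Δ) (hY : Measurable[hτ.measurableSpace] Y)
    (hβ : Measurable[hτ.measurableSpace] β) (hs : ∀ k, Measurable[hτ.measurableSpace] (s k)) :
    (∀ i, IsCondExp hτ.measurableSpace P
      (fun ω => Y ω i + β ω i * (Δ ω : ℝ) +
        ∑ k, s k ω i * (W k (τ ω + Δ ω) ω - W k (τ ω) ω))
      (fun ω => Y ω i + β ω i * (Δ ω : ℝ))) ∧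
    ∀ i j, IsCondExp hτ.measurableSpace P
      (fun ω => (β ω i * (Δ ω : ℝ) + ∑ k, s k ω i * (W k (τ ω + Δ ω) ω - W k (τ ω) ω)) *
        (β ω j * (Δ ω : ℝ) + ∑ k, s k ω j * (W k (τ ω + Δ ω) ω - W k (τ ω) ω)))
      (fun ω => (Δ ω : ℝ) ^ 2 * (β ω i * β ω j) + (Δ ω : ℝ) * ∑ k, s k ω i * s k ω j) := by
  have hle := hτ.measurableSpace_le
  have hΔr : Measurable[hτ.measurableSpace] fun ω => (Δ ω : ℝ) :=
    measurable_coe_nnreal_real.comp hΔ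
  have hYi : ∀ i, Measurable[hτ.measurableSpace] fun ω => Y ω i :=
    fun i => (measurable_pi_apply i).comp hY
  have hβi : ∀ i, Measurable[hτ.measurableSpace] fun ω => β ω i :=
    fun i => (measurable_pi_apply i).comp hβ
  have hsi : ∀ k i, Measurable[hτ.measurableSpace] fun ω => s k ω i :=
    fun k i => (measurable_pi_apply i).comp (hs k)
  -- The localizing events `A n = {R ≤ n}` bound all coefficients and the step-size at once.
  set R : Ω → ℝ := fun ω => (Δ ω : ℝ) + ‖Y ω‖ + ‖β ω‖ + ∑ k, ‖s k ω‖ with hR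
  have hRm : Measurable[hτ.measurableSpace] R :=
    ((hΔr.add (measurable_norm.comp hY)).add (measurable_norm.comp hβ)).add
      (Finset.measurable_fun_sum _ fun k _ => measurable_norm.comp (hs k))
  set A : ℕ → Set Ω := fun n => {ω | R ω ≤ n} with hAdef
  have hA : ∀ n, MeasurableSet[hτ.measurableSpace] (A n) := fun n =>
    measurableSet_le hRm measurable_const
  have hmono : Monotone A := fun n n' h ω (hω : R ω ≤ n) =>
    hω.trans (Nat.cast_le.2 h)
  have hu : (⋃ n, A n) = Set.univ := Set.eq_univ_of_forall fun ω =>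
    Set.mem_iUnion.2 (exists_nat_ge (R ω))
  have hS0 : ∀ ω, 0 ≤ ∑ k, ‖s k ω‖ := fun ω => Finset.sum_nonneg fun k _ => norm_nonneg _
  have bΔ : ∀ n, ∃ C, ∀ ω ∈ A n, |(Δ ω : ℝ)| ≤ C := fun n => ⟨n, fun ω (hω : R ω ≤ n) => by
    rw [abs_of_nonneg (Δ ω).coe_nonneg]
    have := hS0 ω
    have := norm_nonneg (Y ω)
    have := norm_nonneg (β ω)
    simp only [hR] at hω
    linarith⟩
  have bY : ∀ n i, ∃ C, ∀ ω ∈ A n, |Y ω i| ≤ C := fun n i => ⟨n, fun ω (hω : R ω ≤ n) => by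
    have := hS0 ω
    have := norm_le_pi_norm (Y ω) i
    have := norm_nonneg (β ω)
    have : (0 : ℝ) ≤ Δ ω := (Δ ω).coe_nonneg
    simp only [hR, Real.norm_eq_abs] at *
    linarith⟩
  have bβ : ∀ n i, ∃ C, ∀ ω ∈ A n, |β ω i| ≤ C := fun n i => ⟨n, fun ω (hω : R ω ≤ n) => by
    have := hS0 ω
    have := norm_le_pi_norm (β ω) i
    have := norm_nonneg (Y ω)
    have : (0 : ℝ) ≤ Δ ω := (Δ ω).coe_nonneg
    simp only [hR, Real.norm_eq_abs] at *
    linarith⟩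
  have bs : ∀ n k i, ∃ C, ∀ ω ∈ A n, |s k ω i| ≤ C := fun n k i =>
    ⟨n, fun ω (hω : R ω ≤ n) => by
      have := norm_le_pi_norm (s k ω) i
      have := Finset.single_le_sum (f := fun k => ‖s k ω‖) (fun k _ => norm_nonneg _)
        (Finset.mem_univ k)
      have := norm_nonneg (Y ω)
      have := norm_nonneg (β ω)
      have : (0 : ℝ) ≤ Δ ω := (Δ ω).coe_nonneg
      simp only [hR, Real.norm_eq_abs] at *
      linarith⟩
  have X1 := fun n => hW.isCondExpOn_increment hτ hΔ (hA n) (bΔ n)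
  have X2 := fun n => hW.isCondExpOn_increment_mul_increment hτ hΔ (hA n) (bΔ n)
  refine ⟨fun i => isCondExp_of_isCondExpOn hA hmono hu fun n => ?_,
    fun i j => isCondExp_of_isCondExpOn hA hmono hu fun n => ?_⟩
  · have h := ((isCondExpOn_self (P := P) hle (hA n) (hYi i) (bY n i)).add hle (hA n)
      (isCondExpOn_self hle (hA n) ((hβi i).mul hΔr) (exists_bound_mul (bβ n i) (bΔ n)))).add
      hle (hA n) (IsCondExpOn.sum Finset.univ hle (hA n) fun k _ =>
        (X1 n k).mul_left hle (hA n) (hsi k i) (bs n k i))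
    simpa only [Pi.mul_apply, mul_zero, Finset.sum_const_zero, add_zero] using h
  · have hd := isCondExpOn_self (P := P) hle (hA n) (((hβi i).mul hΔr).mul ((hβi j).mul hΔr))
      (exists_bound_mul (exists_bound_mul (bβ n i) (bΔ n)) (exists_bound_mul (bβ n j) (bΔ n)))
    have h1 := fun i j => IsCondExpOn.sum Finset.univ hle (hA n) fun k _ =>
      (X1 n k).mul_left hle (hA n) (((hβi i).mul hΔr).mul (hsi k j))
        (exists_bound_mul (exists_bound_mul (bβ n i) (bΔ n)) (bs n k j))
    have h2 := IsCondExpOn.sum Finset.univ hle (hA n) fun k _ =>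
      IsCondExpOn.sum Finset.univ hle (hA n) fun l _ =>
        (X2 n k l).mul_left hle (hA n) ((hsi k i).mul (hsi l j))
          (exists_bound_mul (bs n k i) (bs n l j))
    have h := ((hd.add hle (hA n) (h1 i j)).add hle (hA n) (h1 j i)).add hle (hA n) h2
    convert h using 2 with ω ω
    · rw [add_mul, mul_add, mul_add, Finset.sum_mul_sum, Finset.mul_sum, Finset.sum_mul,
        ← add_assoc]
      congr 1
      · congr 1
        · simp [mul_assoc]
        · exact Finset.sum_congr rfl fun k _ => by simp; ring
      · exact Finset.sum_congr rfl fun k _ => Finset.sum_congr rfl fun l _ => by simp; ring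
    · simp [Finset.mul_sum]
      ring_nf

end EulerMoments

/-! ### Norm inequalities -/

section Norms

variable {d : ℕ} {p : ℝ≥0∞} {w : Fin d → ℝ}

theorem weightedLpNorm_nonneg [Fact (1 ≤ p)] (x : Fin d → ℝ) : 0 ≤ weightedLpNorm p w x :=
  norm_nonneg _

theorem weightedLpNorm_const_mul [Fact (1 ≤ p)] (c : ℝ) (x : Fin d → ℝ) :
    weightedLpNorm p w (fun i => c * x i) = |c| * weightedLpNorm p w x := by
  have h : (fun i => w i * (c * x i)) = c • fun i => w i * x i := by
    funext i
    simp [mul_left_comm]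
  rw [weightedLpNorm, weightedLpNorm, h, WithLp.toLp_smul, norm_smul, Real.norm_eq_abs]

theorem weightedLpNorm_mono [hp : Fact (1 ≤ p)] {x y : Fin d → ℝ} (h : ∀ i, |x i| ≤ |y i|) :
    weightedLpNorm p w x ≤ weightedLpNorm p w y := by
  have h' : ∀ i, ‖w i * x i‖ ≤ ‖w i * y i‖ := fun i => by
    simp only [norm_mul, Real.norm_eq_abs]
    exact mul_le_mul_of_nonneg_left (h i) (abs_nonneg _)
  unfold weightedLpNorm
  rcases eq_or_ne p ∞ with rfl | hp'
  · simp only [PiLp.norm_eq_ciSup]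
    exact Real.iSup_le (fun i => (h' i).trans
      (le_ciSup (f := fun i => ‖w i * y i‖) (Set.finite_range _).bddAbove i))
      (Real.iSup_nonneg fun i => norm_nonneg _)
  · have hpos : 0 < p.toReal :=
      ENNReal.toReal_pos (zero_lt_one.trans_le hp.out).ne' hp'
    simp only [PiLp.norm_eq_sum hpos]
    gcongr with i
    exact h' i

/-- The matrix of second moments is a combination of rank one matrices, to which the compatibility of
the two norms applies. -/
theorem Seminorm.secondMoment_le {m : ℕ} [Fact (1 ≤ p)]
    (nm : Seminorm ℝ (Matrix (Fin d) (Fin d) ℝ))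
    (hcompat : ∀ x y : Fin d → ℝ,
      nm (Matrix.vecMulVec x y) ≤ weightedLpNorm p w x * weightedLpNorm p w y)
    {δ : ℝ} (hδ : 0 ≤ δ) {e e' : Fin d → ℝ} (he : ∀ i, 0 < e i) (hee' : ∀ i, e i ≤ e' i)
    (β : Fin d → ℝ) (s : Fin m → Fin d → ℝ) :
    nm (Matrix.of fun i j =>
      (δ ^ 2 * (β i * β j) + δ * ∑ k, s k i * s k j) / (2 * e' i * e' j)) ≤
      δ ^ 2 / 2 * (weightedLpNorm p w fun i => β i / e i) ^ 2 +
        δ / 2 * ∑ k, (weightedLpNorm p w fun i => s k i / e' i) ^ 2 := by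
  have he' : ∀ i, 0 < e' i := fun i => (he i).trans_le (hee' i)
  have hM : (Matrix.of fun i j =>
      (δ ^ 2 * (β i * β j) + δ * ∑ k, s k i * s k j) / (2 * e' i * e' j)) =
      (δ ^ 2 / 2) • Matrix.vecMulVec (fun i => β i / e' i) (fun i => β i / e' i) +
        (δ / 2) • ∑ k, Matrix.vecMulVec (fun i => s k i / e' i) (fun i => s k i / e' i) := by
    ext i j
    have h1 := (he' i).ne'
    have h2 := (he' j).ne'
    have h3 : ∑ k, s k i / e' i * (s k j / e' j) = (∑ k, s k i * s k j) / (e' i * e' j) := by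
      rw [Finset.sum_div]
      exact Finset.sum_congr rfl fun k _ => div_mul_div_comm _ _ _ _
    simp only [Matrix.of_apply, Matrix.add_apply, Matrix.smul_apply, Matrix.sum_apply,
      Matrix.vecMulVec_apply, smul_eq_mul, h3]
    field_simp
  have hβ : (weightedLpNorm p w fun i => β i / e' i) ≤ weightedLpNorm p w fun i => β i / e i :=
    weightedLpNorm_mono fun i => by
      rw [abs_div, abs_div, abs_of_pos (he i), abs_of_pos (he' i)]
      exact div_le_div_of_nonneg_left (abs_nonneg _) (he i) (hee' i)
  rw [hM]
  refine (map_add_le_add nm _ _).trans (add_le_add ?_ ?_)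
  · rw [map_smul_eq_mul, Real.norm_of_nonneg (by positivity)]
    gcongr
    refine (hcompat _ _).trans ?_
    rw [← pow_two]
    exact pow_le_pow_left₀ (weightedLpNorm_nonneg _) hβ 2
  · rw [map_smul_eq_mul, Real.norm_of_nonneg (by positivity)]
    gcongr
    refine (Finset.le_sum_of_subadditive nm (map_zero nm).le (map_add_le_add nm) _ _).trans ?_
    exact Finset.sum_le_sum fun k _ => (hcompat _ _).trans_eq (pow_two _).symm

/-- The elementary inequality behind the ancillary local discrepancy function: once
`δ a ≤ 1`, the quadratic term `δ² a²` is at most `δ a`. -/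
theorem sq_div_two_add_le_mul_max {δ a S : ℝ} (hδ : 0 ≤ δ) (ha : 0 ≤ a)
    (h : δ * max a S ≤ 1) : δ ^ 2 / 2 * a ^ 2 + δ / 2 * S ≤ δ * max a S := by
  have h1 : δ * a ≤ δ * max a S := mul_le_mul_of_nonneg_left (le_max_left _ _) hδ
  have h2 : δ * S ≤ δ * max a S := mul_le_mul_of_nonneg_left (le_max_right _ _) hδ
  have h3 : (δ * a) * (δ * a) ≤ δ * a :=
    mul_le_of_le_one_right (mul_nonneg hδ ha) (h1.trans h)
  nlinarith

end Norms

/-! ### The Euler step and its discrepancy functions -/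

theorem lemma1 {Ω : Type*} [mΩ : MeasurableSpace Ω] (P : Measure Ω) [IsProbabilityMeasure P]
    (𝓕 : Filtration ℝ≥0 mΩ) {d m : ℕ}
    (W : Fin m → ℝ≥0 → Ω → ℝ) (hW : IsFilteredBrownian P 𝓕 W)
    -- the coefficients, on `[0, T] × ℝᵈ`
    (T : ℝ≥0)
    (b : ℝ≥0 → (Fin d → ℝ) → Fin d → ℝ) (σ : Fin m → ℝ≥0 → (Fin d → ℝ) → Fin d → ℝ)
    (hb : Measurable
      ((Set.Iic T ×ˢ (Set.univ : Set (Fin d → ℝ))).domRestrict (Function.uncurry b)))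
    (hσ : ∀ k, Measurable
      ((Set.Iic T ×ˢ (Set.univ : Set (Fin d → ℝ))).domRestrict (Function.uncurry (σ k))))
    -- the current time, the current state and the step-size
    (τ : Ω → ℝ≥0) (hτ : IsStoppingTime 𝓕 (fun ω => (τ ω : WithTop ℝ≥0))) (hτT : ∀ ω, τ ω ≤ T)
    (Y : Ω → Fin d → ℝ) (hY : Measurable[hτ.measurableSpace] Y)
    (Δ : Ω → ℝ≥0) (hΔ : Measurable[hτ.measurableSpace] Δ)
    -- the thresholds
    (thr thr' : Fin d → Ω → ℝ)
    (hthr : ∀ i, Measurable[hτ.measurableSpace] (thr i))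
    (hthr' : ∀ i, Measurable[hτ.measurableSpace] (thr' i))
    (hpos : ∀ i ω, 0 < thr i ω) (hle : ∀ i ω, thr i ω ≤ thr' i ω)
    -- the norms on vectors and matrices
    (p : ℝ≥0∞) (hp : 1 ≤ p) (w : Fin d → ℝ) (hw : ∀ i, 0 < w i)
    (nm : Seminorm ℝ (Matrix (Fin d) (Fin d) ℝ))
    (habs : ∀ A, nm A = nm (A.map fun a => |a|))
    (hcompat : ∀ x y : Fin d → ℝ,
      nm (Matrix.vecMulVec x y) ≤ weightedLpNorm p w x * weightedLpNorm p w y) :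
    -- the conditional moments exist
    (∀ i, ∃ g, IsCondExp hτ.measurableSpace P (fun ω => eulerStep b σ W τ Y Δ ω i) g) ∧
    (∀ i j, ∃ g, IsCondExp hτ.measurableSpace P
      (fun ω => (eulerStep b σ W τ Y Δ ω i - Y ω i) * (eulerStep b σ W τ Y Δ ω j - Y ω j)) g) ∧
    -- and all their versions satisfy the two claims
    ∀ M₂ : Fin d → Fin d → Ω → ℝ,
      (∀ i j, IsCondExp hτ.measurableSpace P
        (fun ω => (eulerStep b σ W τ Y Δ ω i - Y ω i) * (eulerStep b σ W τ Y Δ ω j - Y ω j))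
        (M₂ i j)) →
      (∀ᵐ ω ∂P,
        nm (Matrix.of fun i j => M₂ i j ω / (2 * thr' i ω * thr' j ω)) ≤
          (Δ ω : ℝ) ^ 2 / 2 * (weightedLpNorm p w fun i => b (τ ω) (Y ω) i / thr i ω) ^ 2 +
          (Δ ω : ℝ) / 2 *
            ∑ k, (weightedLpNorm p w fun i => σ k (τ ω) (Y ω) i / thr' i ω) ^ 2) ∧
      ∀ M₁ : Fin d → Ω → ℝ,
        (∀ i, IsCondExp hτ.measurableSpace P (fun ω => eulerStep b σ W τ Y Δ ω i) (M₁ i)) →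
        ∀ᵐ ω ∂P,
          ancillaryDiscrepancy (weightedLpNorm p w) thr thr' b σ τ Y Δ ω ≤ 1 →
            localDiscrepancy (weightedLpNorm p w) nm thr thr' Y M₁ M₂ ω ≤
              ancillaryDiscrepancy (weightedLpNorm p w) thr thr' b σ τ Y Δ ω ∧
            localDiscrepancy (weightedLpNorm p w) nm thr thr' Y M₁ M₂ ω ≤ 1 := by
  have : Fact (1 ≤ p) := ⟨hp⟩
  have hsub := hτ.measurableSpace_le
  have hcomp : ∀ c : ℝ≥0 → (Fin d → ℝ) → Fin d → ℝ,
      Measurable ((Set.Iic T ×ˢ (Set.univ : Set (Fin d → ℝ))).domRestrict (Function.uncurry c)) →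
      Measurable[hτ.measurableSpace] fun ω => c (τ ω) (Y ω) := fun c hc =>
    hc.comp ((hτ.measurable_of_coe.prodMk hY).subtype_mk
      (h := fun ω => ⟨hτT ω, Set.mem_univ _⟩))
  obtain ⟨hmom1, hmom2⟩ := hW.isCondExp_step hτ hΔ hY (hcomp b hb) fun k => hcomp (σ k) (hσ k)
  have hincr : ∀ i ω, eulerStep b σ W τ Y Δ ω i - Y ω i = b (τ ω) (Y ω) i * (Δ ω : ℝ) +
      ∑ k, σ k (τ ω) (Y ω) i * (W k (τ ω + Δ ω) ω - W k (τ ω) ω) := fun i ω => by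
    rw [eulerStep]
    ring
  simp only [hincr]
  refine ⟨fun i => ⟨_, hmom1 i⟩, fun i j => ⟨_, hmom2 i j⟩, fun M₂ hM₂ => ?_⟩
  have hsecond : ∀ᵐ ω ∂P, ∀ i j, M₂ i j ω =
      (Δ ω : ℝ) ^ 2 * (b (τ ω) (Y ω) i * b (τ ω) (Y ω) j) +
        (Δ ω : ℝ) * ∑ k, σ k (τ ω) (Y ω) i * σ k (τ ω) (Y ω) j :=
    ae_all_iff.2 fun i => ae_all_iff.2 fun j => (hM₂ i j).ae_eq hsub (hmom2 i j)
  have hbound : ∀ᵐ ω ∂P, nm (Matrix.of fun i j => M₂ i j ω / (2 * thr' i ω * thr' j ω)) ≤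
      (Δ ω : ℝ) ^ 2 / 2 * (weightedLpNorm p w fun i => b (τ ω) (Y ω) i / thr i ω) ^ 2 +
        (Δ ω : ℝ) / 2 *
          ∑ k, (weightedLpNorm p w fun i => σ k (τ ω) (Y ω) i / thr' i ω) ^ 2 := by
    filter_upwards [hsecond] with ω hω
    simp only [hω]
    exact nm.secondMoment_le hcompat (Δ ω).coe_nonneg (fun i => hpos i ω) (fun i => hle i ω) _ _
  refine ⟨hbound, fun M₁ hM₁ => ?_⟩
  have hfirst : ∀ᵐ ω ∂P, ∀ i, M₁ i ω = Y ω i + b (τ ω) (Y ω) i * (Δ ω : ℝ) :=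
    ae_all_iff.2 fun i => (hM₁ i).ae_eq hsub (hmom1 i)
  filter_upwards [hbound, hfirst] with ω h2 h1 hanc
  suffices h : localDiscrepancy (weightedLpNorm p w) nm thr thr' Y M₁ M₂ ω ≤
      ancillaryDiscrepancy (weightedLpNorm p w) thr thr' b σ τ Y Δ ω from ⟨h, h.trans hanc⟩
  have hΔ0 : (0 : ℝ) ≤ Δ ω := (Δ ω).coe_nonneg
  refine max_le ?_ ?_
  · have hvec : (fun i => (M₁ i ω - Y ω i) / thr i ω) =
        fun i => (Δ ω : ℝ) * (b (τ ω) (Y ω) i / thr i ω) := by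
      funext i
      rw [h1 i]
      ring
    rw [hvec, weightedLpNorm_const_mul, abs_of_nonneg hΔ0]
    exact mul_le_mul_of_nonneg_left (le_max_left _ _) hΔ0
  · simp only [← mul_assoc]
    exact h2.trans (sq_div_two_add_le_mul_max hΔ0 (weightedLpNorm_nonneg _) hanc)
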